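/- Let $M$ be a manifold modelled on an infinite-dimensional convenient vector space $E$ (a Hausdorff locally convex space in which every smooth curve has a smooth antiderivative), with the kinematic tangent bundle $TM$ and the kinematic cotangent bundle $T'M$, whose fibre $T'_pM$ consists of the bounded linear functionals on $T_pM$ (for Fréchet or Banach manifolds: the continuous ones). Let $\eta$ be a smooth 1-form on $M$ whose exterior derivative $d\eta$ is degenerate at every point, i.e. for every $p\in M$ there is $0\neq v\in T_pM$ with $d\eta_p(v,\cdot)=0$. For $p\in M$ put $H_p=\ker\eta_p$ and $V_p=\ker d\eta_p=\{v\in T_pM : d\eta_p(v,\cdot)=0\}$. The following are equivalent: 1. $TM=H\oplus V$ fibrewise, i.e. $T_pM=H_p\oplus V_p$ for every $p\in M$; 2. $d\eta$ is weakly non-degenerate on $H$, i.e. for every $p\in M$, the only $v\in H_p$ with $d\eta_p(v,w)=0$ for all $w\in H_p$ is $v=0$; 3. the bundle homomorphism $\flat\colon TM\to T'M$ over the identity of $M$ given by $\flat(v)=\iota_v d\eta+\eta(v)\,\eta$ (which is linear on the fibres) is injective. A 1-form as above that satisfies these equivalent conditions is called a (weakly) contact form. -/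

import Mathlib

open Filter Set
open scoped Topology ContDiff

namespace ConvenientGeometry

set_option linter.unusedSectionVars false

section Curves

variable {F : Type*} [AddCommGroup F] [Module ℝ F] [TopologicalSpace F]

/-- The curve `c` has derivative `v` at time `t`: the difference quotients
`(c (t + h) - c t) / h` converge to `v` as `h → 0`. -/
def HasVelocity (c : ℝ → F) (v : F) (t : ℝ) : Prop :=
  Tendsto (fun h : ℝ => h⁻¹ • (c (t + h) - c t)) (𝓝[≠] 0) (𝓝 v)

/-- The derivative `c' t` of a curve (meaningful where the difference quotients converge). -/
noncomputable def velocity (c : ℝ → F) (t : ℝ) : F :=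
  haveI : Nonempty F := ⟨0⟩
  limUnder (𝓝[≠] (0 : ℝ)) (fun h : ℝ => h⁻¹ • (c (t + h) - c t))

/-- `c` is a smooth curve on the open set `s` of times: all iterated derivatives
`c = d 0, c' = d 1, c'' = d 2, …` exist at every point of `s` (they are then automatically
continuous on `s`). -/
def SmoothCurveOn (c : ℝ → F) (s : Set ℝ) : Prop :=
  ∃ d : ℕ → ℝ → F, d 0 = c ∧ ∀ n, ∀ t ∈ s, HasVelocity (d n) (d (n + 1) t) t

theorem HasVelocity.velocity_eq [T2Space F] {c : ℝ → F} {v : F} {t : ℝ}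
    (h : HasVelocity c v t) : velocity c t = v := by
  unfold velocity
  exact h.limUnder_eq

theorem SmoothCurveOn.hasVelocity [T2Space F] {c : ℝ → F} {s : Set ℝ} (h : SmoothCurveOn c s)
    {t : ℝ} (ht : t ∈ s) : HasVelocity c (velocity c t) t := by
  obtain ⟨d, rfl, hd⟩ := h
  have := hd 0 t ht
  rwa [this.velocity_eq]

theorem HasVelocity.congr {c c' : ℝ → F} {v : F} {t : ℝ} (h : HasVelocity c v t)
    (hc : c =ᶠ[𝓝 t] c') : HasVelocity c' v t := by
  refine Tendsto.congr' ?_ h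
  have h1 : Tendsto (fun h : ℝ => t + h) (𝓝[≠] 0) (𝓝 t) := by
    have : Tendsto (fun h : ℝ => t + h) (𝓝 0) (𝓝 (t + 0)) := by
      exact (continuous_const.add continuous_id).tendsto 0
    simpa using this.mono_left nhdsWithin_le_nhds
  filter_upwards [h1.eventually hc] with h hh
  rw [hh, hc.eq_of_nhds]

theorem HasVelocity.const (a : F) (t : ℝ) : HasVelocity (fun _ => a) (0 : F) t := by
  simp [HasVelocity, tendsto_const_nhds]

theorem hasVelocity_real {c : ℝ → ℝ} {v t : ℝ} : HasVelocity c v t ↔ HasDerivAt c v t :=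
  hasDerivAt_iff_tendsto_slope_zero.symm

section
variable [IsTopologicalAddGroup F] [ContinuousSMul ℝ F]

theorem HasVelocity.add {c c' : ℝ → F} {v v' : F} {t : ℝ} (h : HasVelocity c v t)
    (h' : HasVelocity c' v' t) : HasVelocity (fun s => c s + c' s) (v + v') t := by
  refine (Tendsto.add h h').congr fun x => ?_
  rw [← smul_add]
  rw [show c (t + x) - c t + (c' (t + x) - c' t) = c (t + x) + c' (t + x) - (c t + c' t) from
    (add_sub_add_comm _ _ _ _).symm]

theorem HasVelocity.smul_const {r : ℝ → ℝ} {r' t : ℝ} (h : HasDerivAt r r' t) (e : F) :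
    HasVelocity (fun s => r s • e) (r' • e) t := by
  have := (hasVelocity_real.2 h)
  refine (Tendsto.smul_const this e).congr fun x => ?_
  rw [← sub_smul, smul_smul, smul_eq_mul]

theorem HasVelocity.sum {ι : Type*} (A : Finset ι) {c : ι → ℝ → F} {v : ι → F} {t : ℝ}
    (h : ∀ i ∈ A, HasVelocity (c i) (v i) t) :
    HasVelocity (fun s => ∑ i ∈ A, c i s) (∑ i ∈ A, v i) t := by
  classical
  induction A using Finset.induction_on with
  | empty => simpa using HasVelocity.const (0 : F) t
  | insert a A ha ih =>
    simp only [Finset.sum_insert ha]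
    exact (h a (by simp)).add (ih fun i hi => h i (by simp [hi]))

theorem HasVelocity.comp_clm {G : Type*} [AddCommGroup G] [Module ℝ G] [TopologicalSpace G]
    (L : F →L[ℝ] G) {c : ℝ → F} {v : F} {t : ℝ} (h : HasVelocity c v t) :
    HasVelocity (fun s => L (c s)) (L v) t := by
  refine ((L.continuous.tendsto v).comp h).congr fun x => ?_
  simp

theorem HasVelocity.continuousAt {c : ℝ → F} {v : F} {t : ℝ} (h : HasVelocity c v t) :
    ContinuousAt c t := by
  have h0 : Tendsto (fun h : ℝ => h) (𝓝[≠] (0 : ℝ)) (𝓝 0) := nhdsWithin_le_nhds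
  have h1 : Tendsto (fun h : ℝ => h • (h⁻¹ • (c (t + h) - c t)) + c t) (𝓝[≠] 0)
      (𝓝 ((0 : ℝ) • v + c t)) := (h0.smul h).add_const _
  have h2 : Tendsto (fun h : ℝ => c (t + h)) (𝓝[≠] 0) (𝓝 (c t)) := by
    rw [zero_smul, zero_add] at h1
    refine h1.congr' ?_
    filter_upwards [self_mem_nhdsWithin] with x hx
    rw [smul_smul, mul_inv_cancel₀ hx, one_smul, sub_add_cancel]
  have h3 : Tendsto (fun h : ℝ => c (t + h)) (𝓝 0) (𝓝 (c t)) := by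
    have h6 : ContinuousAt (fun h : ℝ => c (t + h)) 0 := by
      refine continuousWithinAt_compl_self.1 ?_
      simpa [ContinuousWithinAt] using h2
    simpa [ContinuousAt] using h6
  have h4 : Tendsto (fun x : ℝ => x - t) (𝓝 t) (𝓝 0) := by
    have : Tendsto (fun x : ℝ => x - t) (𝓝 t) (𝓝 (t - t)) :=
      (continuous_id.sub continuous_const).tendsto t
    simpa using this
  have h5 := h3.comp h4
  simpa [ContinuousAt, Function.comp_def] using h5

end

end Curves

/-! Helper facts: smooth curves that probe a function near a point. They serve to show that
directional derivatives are linear and bounded in the direction. -/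

section Bumps

variable {F : Type*} [AddCommGroup F] [Module ℝ F] [TopologicalSpace F]

theorem SmoothCurveOn.contDiffOn {g : ℝ → ℝ} {s : Set ℝ} (hs : IsOpen s)
    (h : SmoothCurveOn g s) : ContDiffOn ℝ ∞ g s := by
  obtain ⟨d, rfl, hd⟩ := h
  simp only [hasVelocity_real] at hd
  have key : ∀ k n : ℕ, ContDiffOn ℝ k (d n) s := by
    intro k
    induction k with
    | zero =>
      intro n
      have : ContinuousOn (d n) s := fun t ht => (hd n t ht).continuousAt.continuousWithinAt
      simpa using this
    | succ k ih =>
      intro n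
      push_cast
      rw [contDiffOn_succ_iff_deriv_of_isOpen hs]
      refine ⟨fun t ht => (hd n t ht).differentiableAt.differentiableWithinAt, by simp, ?_⟩
      exact (ih (n + 1)).congr fun t ht => (hd n t ht).deriv
  exact contDiffOn_infty.2 fun k => key k 0

theorem SmoothCurveOn.mono {c : ℝ → F} {s s' : Set ℝ} (h : SmoothCurveOn c s)
    (hs : s' ⊆ s) : SmoothCurveOn c s' := by
  obtain ⟨d, rfl, hd⟩ := h
  exact ⟨d, rfl, fun n t ht => hd n t (hs ht)⟩

variable [IsTopologicalAddGroup F] [ContinuousSMul ℝ F]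

theorem SmoothCurveOn.continuous {c : ℝ → F} (h : SmoothCurveOn c univ) : Continuous c := by
  obtain ⟨d, rfl, hd⟩ := h
  exact continuous_iff_continuousAt.2 fun t => (hd 0 t (mem_univ t)).continuousAt

theorem SmoothCurveOn.add {c c' : ℝ → F} {s : Set ℝ} (h : SmoothCurveOn c s)
    (h' : SmoothCurveOn c' s) : SmoothCurveOn (fun t => c t + c' t) s := by
  obtain ⟨d, rfl, hd⟩ := h
  obtain ⟨d', rfl, hd'⟩ := h'
  exact ⟨fun n t => d n t + d' n t, rfl, fun n t ht => (hd n t ht).add (hd' n t ht)⟩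

theorem smoothCurveOn_line (y w : F) (s : Set ℝ) : SmoothCurveOn (fun t : ℝ => y + t • w) s := by
  refine ⟨fun n => match n with
    | 0 => fun t => y + t • w
    | 1 => fun _ => w
    | _ => fun _ => 0, rfl, ?_⟩
  intro n t _
  match n with
  | 0 =>
    have := (HasVelocity.const y t).add (HasVelocity.smul_const (hasDerivAt_id t) w)
    simpa using this
  | 1 => exact HasVelocity.const w t
  | n + 2 => exact HasVelocity.const 0 t

/-- A smooth curve performing infinitely many rapidly shrinking excursions near time `0`. -/
theorem exists_bumpCurve {σ : ℝ → ℝ} (hσ : ContDiff ℝ ∞ σ) (hsupp : ∀ r, 1 / 4 < |r| → σ r = 0)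
    {e : ℕ → F} (he : Bornology.IsVonNBounded ℝ (range e)) :
    ∃ c : ℝ → F, SmoothCurveOn c univ ∧ c 0 = 0 ∧
      ∀ (n : ℕ) (s : ℝ), |2 ^ n * s| ≤ 1 / 4 →
        c ((1 / 2) ^ n + s) = ((1 / 2) ^ (n * n) * σ (2 ^ n * s)) • e n := by
  have hsupp' : ∀ k r, 1 / 4 < |r| → iteratedDeriv k σ r = 0 := by
    intro k r hr
    have : σ =ᶠ[𝓝 r] fun _ => (0 : ℝ) := by
      filter_upwards [(isOpen_lt continuous_const continuous_abs).mem_nhds hr] with x hx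
      exact hsupp x hx
    rw [this.iteratedDeriv_eq k]
    simp
  have hbd : ∀ k, ∃ C : ℝ, 0 ≤ C ∧ ∀ r, |iteratedDeriv k σ r| ≤ C := by
    intro k
    obtain ⟨C, hC⟩ := (isCompact_Icc (a := -(1 / 4 : ℝ)) (b := 1 / 4)).exists_bound_of_continuousOn
      (hσ.continuous_iteratedDeriv k (by exact_mod_cast le_top)).continuousOn
    refine ⟨max C 0, le_max_right _ _, fun r => ?_⟩
    by_cases hr : 1 / 4 < |r|
    · rw [hsupp' k r hr]; simp
    · exact (hC r (abs_le.1 (not_lt.1 hr))).trans (le_max_left _ _)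
  let T : ℕ → ℕ → ℝ → ℝ := fun k n t =>
    (1 / 2) ^ (n * n) * ((2 ^ n) ^ k * iteratedDeriv k σ (2 ^ n * t - 1))
  have hT0 : ∀ k n t, 1 / 4 < |2 ^ n * t - 1| → T k n t = 0 := by
    intro k n t h
    simp only [T]
    rw [hsupp' k _ h]
    simp
  have hTd : ∀ k n t, HasDerivAt (T k n) (T (k + 1) n t) t := by
    intro k n t
    have h1 : HasDerivAt (iteratedDeriv k σ) (iteratedDeriv (k + 1) σ (2 ^ n * t - 1))
        (2 ^ n * t - 1) := by
      rw [iteratedDeriv_succ]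
      exact (hσ.differentiable_iteratedDeriv k (by exact_mod_cast ENat.natCast_lt_top k) _).hasDerivAt
    have h2 : HasDerivAt (fun t : ℝ => 2 ^ n * t - 1) (2 ^ n) t := by
      simpa using ((hasDerivAt_id t).const_mul ((2 : ℝ) ^ n)).sub_const 1
    have h3 := ((h1.comp t h2).const_mul (((2 : ℝ) ^ n) ^ k)).const_mul ((1 / 2 : ℝ) ^ (n * n))
    refine h3.congr_deriv ?_
    simp only [T]
    ring
  have hsingle : ∀ (n : ℕ) (t : ℝ), |2 ^ n * t - 1| ≤ 1 / 4 → ∀ m, m ≠ n → ∀ k, T k m t = 0 := by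
    intro n t hn m hmn k
    apply hT0
    by_contra hm
    rw [not_lt] at hm
    rw [abs_le] at hn hm
    have aux : ∀ a b : ℕ, a < b → 3 / 4 ≤ 2 ^ a * t → 2 ^ b * t ≤ 5 / 4 → False := by
      intro a b hab h1 h2
      have ht : 0 < t := by
        by_contra h
        have : (2 : ℝ) ^ a * t ≤ 0 :=
          mul_nonpos_of_nonneg_of_nonpos (by positivity) (not_lt.1 h)
        linarith
      have h3 : (2 : ℝ) ^ (a + 1) ≤ 2 ^ b := pow_le_pow_right₀ (by norm_num) hab
      have h4 : (2 : ℝ) ^ (a + 1) * t ≤ 2 ^ b * t := mul_le_mul_of_nonneg_right h3 ht.le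
      rw [pow_succ] at h4
      linarith
    rcases lt_or_gt_of_ne hmn with h | h
    · exact aux m n h (by linarith) (by linarith)
    · exact aux n m h (by linarith) (by linarith)
  let d : ℕ → ℝ → F := fun k t => ∑ᶠ n, T k n t • e n
  have hd1 : ∀ (n : ℕ) (t : ℝ), |2 ^ n * t - 1| ≤ 1 / 4 → ∀ k, d k t = T k n t • e n := by
    intro n t h k
    refine finsum_eq_single _ n fun m hm => ?_
    rw [hsingle n t h m hm k, zero_smul]
  have hd2 : ∀ t : ℝ, (∀ n : ℕ, 1 / 4 < |2 ^ n * t - 1|) → ∀ k, d k t = 0 := by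
    intro t h k
    simp only [d]
    rw [← finsum_zero (α := ℕ)]
    congr 1
    ext n
    rw [hT0 k n t (h n), zero_smul]
  have hd0 : ∀ k, d k 0 = 0 := fun k => hd2 0 (fun n => by norm_num) k
  refine ⟨d 0, ⟨d, rfl, ?_⟩, hd0 0, ?_⟩
  · intro k t _
    by_cases ht : t = 0
    · subst ht
      rw [hd0 (k + 1)]
      obtain ⟨C, hC0, hC⟩ := hbd k
      have hex : ∀ h : ℝ, ∃ n : ℕ, d k h = T k n h • e n ∧
          |h⁻¹ * T k n h| ≤ (2 * C * 2 ^ ((k + 2) * (k + 2))) * |h| := by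
        intro h
        by_cases hh : ∃ n : ℕ, |2 ^ n * h - 1| ≤ 1 / 4
        · obtain ⟨n, hn⟩ := hh
          refine ⟨n, hd1 n h hn k, ?_⟩
          rw [abs_le] at hn
          have hh0 : 0 < h := by
            by_contra h'
            have : (2 : ℝ) ^ n * h ≤ 0 :=
              mul_nonpos_of_nonneg_of_nonpos (by positivity) (not_lt.1 h')
            linarith
          have hp : (0 : ℝ) < 2 ^ n := by positivity
          have e1 : h⁻¹ ≤ 4 / 3 * 2 ^ n := by
            rw [inv_le_iff_one_le_mul₀ hh0]
            linarith
          have e2 : (1 / 2 : ℝ) ^ n ≤ 4 / 3 * h := by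
            rw [one_div, inv_pow, inv_le_iff_one_le_mul₀ hp]
            linarith
          have e3 : ((2 : ℝ) ^ n) ^ (k + 2) ≤ 2 ^ (n * n) * 2 ^ ((k + 2) * (k + 2)) := by
            rw [← pow_mul, ← pow_add]
            refine pow_le_pow_right₀ (by norm_num) ?_
            nlinarith [Nat.zero_le (n * n), Nat.zero_le ((k + 2) * (k + 2)), le_total n (k + 2),
              sq_nonneg ((n : ℤ) - (k + 2))]
          have e4 : (1 / 2 : ℝ) ^ (n * n) * 2 ^ (n * n) = 1 := by
            rw [← mul_pow]; norm_num
          have e5 : (1 / 2 : ℝ) ^ n * 2 ^ n = 1 := by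
            rw [← mul_pow]; norm_num
          have e6 : |T k n h| ≤ (1 / 2) ^ (n * n) * ((2 ^ n) ^ k * C) := by
            simp only [T]
            rw [abs_mul, abs_mul, abs_of_pos (by positivity : (0 : ℝ) < (1 / 2) ^ (n * n)),
              abs_of_pos (by positivity : (0 : ℝ) < (2 ^ n) ^ k)]
            gcongr
            exact hC _
          rw [abs_mul, abs_of_pos (inv_pos.2 hh0), abs_of_pos hh0]
          calc h⁻¹ * |T k n h|
              ≤ (4 / 3 * 2 ^ n) * ((1 / 2) ^ (n * n) * ((2 ^ n) ^ k * C)) := by gcongr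
            _ = (4 / 3 * C) * (1 / 2) ^ (n * n) * ((2 ^ n) ^ (k + 2)) * (1 / 2) ^ n := by
                have : ((2 : ℝ) ^ n) ^ (k + 2) = (2 ^ n) ^ k * 2 ^ n * 2 ^ n := by ring
                rw [this]
                linear_combination (-(4 / 3 * C) * (1 / 2) ^ (n * n) * (2 ^ n) ^ k * 2 ^ n) * e5
            _ ≤ (4 / 3 * C) * (1 / 2) ^ (n * n) * (2 ^ (n * n) * 2 ^ ((k + 2) * (k + 2)))
                  * (4 / 3 * h) := by gcongr
            _ = (16 / 9 * C * 2 ^ ((k + 2) * (k + 2))) * h := by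
                linear_combination (16 / 9 * C * 2 ^ ((k + 2) * (k + 2)) * h) * e4
            _ ≤ (2 * C * 2 ^ ((k + 2) * (k + 2))) * h := by
                gcongr
                norm_num
        · push Not at hh
          refine ⟨0, ?_, ?_⟩
          · rw [hd2 h hh k, hT0 k 0 h (hh 0), zero_smul]
          · rw [hT0 k 0 h (hh 0), mul_zero, abs_zero]
            positivity
      choose n hn1 hn2 using hex
      have hlim : Tendsto (fun h : ℝ => h⁻¹ * T k (n h) h) (𝓝[≠] 0) (𝓝 0) := by
        refine squeeze_zero_norm hn2 ?_
        have : Tendsto (fun h : ℝ => (2 * C * 2 ^ ((k + 2) * (k + 2))) * |h|) (𝓝 0)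
            (𝓝 ((2 * C * 2 ^ ((k + 2) * (k + 2))) * |(0 : ℝ)|)) :=
          (continuous_const.mul continuous_abs).tendsto 0
        rw [abs_zero, mul_zero] at this
        exact this.mono_left nhdsWithin_le_nhds
      have := he.smul_tendsto_zero (x := fun h => e (n h))
        (Eventually.of_forall fun h => mem_range_self (n h)) hlim
      refine this.congr fun h => ?_
      simp only [Pi.smul_apply', zero_add]
      rw [hd0 k, sub_zero, hn1 h, smul_smul]
    · obtain ⟨N, hN⟩ := pow_unbounded_of_one_lt (5 / 4 / (|t| / 2)) (one_lt_two (α := ℝ))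
      have ht' : 0 < |t| / 2 := by positivity
      rw [div_lt_iff₀ ht'] at hN
      have hev : ∀ x : ℝ, |t| / 2 < |x| → ∀ k, d k x = ∑ m ∈ Finset.range N, T k m x • e m := by
        intro x hx k
        refine finsum_eq_sum_of_support_subset _ ?_
        intro m hm
        by_contra hmN
        have hmN : N ≤ m := by simpa using hmN
        refine hm ?_
        show T k m x • e m = 0
        rw [hT0 k m x, zero_smul]
        have h1 : (2 : ℝ) ^ N ≤ 2 ^ m := pow_le_pow_right₀ (by norm_num) hmN
        have h2 : (2 : ℝ) ^ N * (|t| / 2) ≤ 2 ^ m * |x| := by gcongr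
        have h3 : |2 ^ m * x| - |(1 : ℝ)| ≤ |2 ^ m * x - 1| := abs_sub_abs_le_abs_sub _ _
        rw [abs_mul, abs_of_pos (by positivity : (0 : ℝ) < 2 ^ m), abs_one] at h3
        linarith
      have htt : |t| / 2 < |t| := by linarith
      rw [hev t htt (k + 1)]
      have : HasVelocity (fun x => ∑ m ∈ Finset.range N, T k m x • e m)
          (∑ m ∈ Finset.range N, T (k + 1) m t • e m) t :=
        HasVelocity.sum _ fun m _ => HasVelocity.smul_const (hTd k m t) (e m)
      refine this.congr ?_
      filter_upwards [(isOpen_lt continuous_const continuous_abs).mem_nhds htt] with x hx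
      exact (hev x hx k).symm
  · intro n s hs
    have e5 : (2 : ℝ) ^ n * (1 / 2) ^ n = 1 := by
      rw [← mul_pow]; norm_num
    have h1 : (2 : ℝ) ^ n * ((1 / 2) ^ n + s) - 1 = 2 ^ n * s := by
      rw [mul_add, e5]; ring
    rw [hd1 n _ (by rwa [h1]) 0]
    simp only [T]
    rw [h1]
    simp

end Bumps

section SmoothMaps

variable {E F : Type*} [AddCommGroup E] [Module ℝ E] [TopologicalSpace E]
  [AddCommGroup F] [Module ℝ F] [TopologicalSpace F]

/-- `f` is smooth on the open set `U` in the sense of convenient calculus: it maps smooth curves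
in `U` to smooth curves. The curves may be defined on any open set of times; as smoothness of a
curve is local in time, this is the same as testing on curves defined on all of `ℝ`. -/
def SmoothMapOn (f : E → F) (U : Set E) : Prop :=
  ∀ (c : ℝ → E) (s : Set ℝ), IsOpen s → SmoothCurveOn c s → MapsTo c s U →
    SmoothCurveOn (f ∘ c) s

/-- The derivative of `f` at `x` in the direction `u`. -/
noncomputable def dirDeriv (f : E → F) (x u : E) : F :=
  velocity (fun s : ℝ => f (x + s • u)) 0

variable [IsTopologicalAddGroup E] [ContinuousSMul ℝ E]

theorem exists_probingCurve (x : E) {b w : ℕ → E} (hb : Bornology.IsVonNBounded ℝ (range b))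
    (hw : Bornology.IsVonNBounded ℝ (range w)) :
    ∃ c : ℝ → E, SmoothCurveOn c univ ∧ c 0 = x ∧ ∀ n : ℕ, ∀ᶠ s : ℝ in 𝓝 0,
      c ((1 / 2) ^ n + s) = x + (1 / 2 : ℝ) ^ (n * n) • b n +
        ((1 / 2) ^ (n * n) * 2 ^ n * s) • w n := by
  let ρ : ContDiffBump (0 : ℝ) := ⟨1 / 8, 1 / 4, by norm_num, by norm_num⟩
  have hρ : ContDiff ℝ ∞ ρ := ρ.contDiff
  have hρ0 : ∀ r, 1 / 4 < |r| → ρ r = 0 := fun r hr =>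
    ρ.zero_of_le_dist (show (1 / 4 : ℝ) ≤ dist r 0 by rw [Real.dist_eq, sub_zero]; exact hr.le)
  obtain ⟨c₁, h1, h1', h1''⟩ := exists_bumpCurve hρ hρ0 hb
  obtain ⟨c₂, h2, h2', h2''⟩ := exists_bumpCurve (σ := fun r => r * ρ r) (contDiff_id.mul hρ)
    (fun r hr => by rw [hρ0 r hr, mul_zero]) hw
  have h0 : SmoothCurveOn (fun _ : ℝ => x) univ := by
    simpa using smoothCurveOn_line x 0 univ
  refine ⟨fun t => x + c₁ t + c₂ t, (h0.add h1).add h2, by simp [h1', h2'], fun n => ?_⟩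
  have hev : ∀ᶠ s : ℝ in 𝓝 0, |2 ^ n * s| < 1 / 8 := by
    have : Continuous fun s : ℝ => |2 ^ n * s| := by fun_prop
    exact (isOpen_lt this continuous_const).mem_nhds (by simp)
  filter_upwards [hev] with s hs
  have hone : ρ (2 ^ n * s) = 1 := ρ.one_of_mem_closedBall
    (show dist (2 ^ n * s) 0 ≤ (1 / 8 : ℝ) by rw [Real.dist_eq, sub_zero]; exact hs.le)
  rw [h1'' n s (by linarith), h2'' n s (by linarith), hone]
  simp [mul_assoc]

theorem iteratedDeriv_comp_mul (k : ℕ) (g : ℝ → ℝ) (m t : ℝ) :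
    iteratedDeriv k (fun s => g (m * s)) t = m ^ k * iteratedDeriv k g (m * t) := by
  induction k generalizing t with
  | zero => simp
  | succ k ih =>
    rw [iteratedDeriv_succ, iteratedDeriv_succ, funext ih, deriv_const_mul_field,
      deriv_comp_mul_left, smul_eq_mul, pow_succ]
    ring

theorem SmoothMapOn.bounded_probe {f : E → ℝ} {U : Set E} (hf : SmoothMapOn f U) (hU : IsOpen U)
    {x : E} (hx : x ∈ U) {b w : ℕ → E} (hb : Bornology.IsVonNBounded ℝ (range b))
    (hw : Bornology.IsVonNBounded ℝ (range w)) (k : ℕ) :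
    ∃ C : ℝ, ∀ᶠ n : ℕ in atTop, |((1 / 2) ^ (n * n) * 2 ^ n) ^ k *
      iteratedDeriv k (fun s : ℝ => f (x + (1 / 2 : ℝ) ^ (n * n) • b n + s • w n)) 0| ≤ C := by
  obtain ⟨c, hc, hc0, hcn⟩ := exists_probingCurve x hb hw
  have hV : IsOpen (c ⁻¹' U) := hU.preimage hc.continuous
  have hg := (hf c (c ⁻¹' U) hV (hc.mono (subset_univ _)) (fun _ h => h)).contDiffOn hV
  have h0 : (0 : ℝ) ∈ c ⁻¹' U := by simpa [hc0] using hx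
  have hcont : ContinuousAt (iteratedDeriv k (f ∘ c)) 0 := by
    have h1 := hg.continuousOn_iteratedDerivWithin (m := k) (by exact_mod_cast le_top)
      hV.uniqueDiffOn
    refine (h1.continuousAt (hV.mem_nhds h0)).congr ?_
    filter_upwards [hV.mem_nhds h0] with t ht
    exact iteratedDerivWithin_of_isOpen hV ht
  refine ⟨|iteratedDeriv k (f ∘ c) 0| + 1, ?_⟩
  have hlim : Tendsto (fun n : ℕ => (1 / 2 : ℝ) ^ n) atTop (𝓝 0) :=
    tendsto_pow_atTop_nhds_zero_of_lt_one (by norm_num) (by norm_num)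
  have := (hcont.abs.tendsto.comp hlim).eventually (gt_mem_nhds (lt_add_one _))
  filter_upwards [this] with n hn
  refine le_of_eq_of_le ?_ hn.le
  simp only [Function.comp_apply]
  congr 1
  have e1 : iteratedDeriv k (f ∘ c) ((1 / 2) ^ n) =
      iteratedDeriv k (fun s => (f ∘ c) ((1 / 2) ^ n + s)) 0 := by
    rw [iteratedDeriv_comp_const_add]
    simp
  have e2 : (fun s => (f ∘ c) ((1 / 2) ^ n + s)) =ᶠ[𝓝 0] fun s =>
      (fun s : ℝ => f (x + (1 / 2 : ℝ) ^ (n * n) • b n + s • w n))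
        (((1 / 2) ^ (n * n) * 2 ^ n) * s) := by
    filter_upwards [hcn n] with s hs
    simp only [Function.comp_apply]
    rw [hs]
  have e3 := e2.iteratedDeriv_eq k
  have e4 := iteratedDeriv_comp_mul k
    (fun s : ℝ => f (x + (1 / 2 : ℝ) ^ (n * n) • b n + s • w n)) ((1 / 2) ^ (n * n) * 2 ^ n) 0
  rw [mul_zero] at e4
  exact e4.symm.trans (e3.symm.trans e1.symm)

theorem SmoothMapOn.contDiffAt_line {f : E → ℝ} {U : Set E} (hf : SmoothMapOn f U)
    (hU : IsOpen U) {x : E} (w : E) {t : ℝ} (hx : x + t • w ∈ U) :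
    ContDiffAt ℝ ∞ (fun s : ℝ => f (x + s • w)) t := by
  have hcont : Continuous fun s : ℝ => x + s • w := by fun_prop
  have hV := hU.preimage hcont
  exact ((hf _ _ hV (smoothCurveOn_line x w _) fun _ h => h).contDiffOn hV).contDiffAt
    (hV.mem_nhds hx)

theorem SmoothMapOn.hasVelocity_line [T2Space F] {f : E → F} {U : Set E} (hf : SmoothMapOn f U)
    (hU : IsOpen U) {x : E} (hx : x ∈ U) (w : E) :
    HasVelocity (fun s : ℝ => f (x + s • w)) (dirDeriv f x w) 0 := by
  have hcont : Continuous fun s : ℝ => x + s • w := by fun_prop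
  have hV := hU.preimage hcont
  exact (hf _ _ hV (smoothCurveOn_line x w _) fun _ h => h).hasVelocity (by simpa using hx)

theorem SmoothMapOn.locally_bounded {f : E → ℝ} {U : Set E} (hf : SmoothMapOn f U)
    (hU : IsOpen U) {x : E} (hx : x ∈ U) (u v w : E) (k : ℕ) :
    ∃ C r : ℝ, 0 < r ∧ ∀ a b : ℝ, |a| ≤ r → |b| ≤ r →
      |iteratedDeriv k (fun s : ℝ => f (x + (a • u + b • v) + s • w)) 0| ≤ C := by
  by_contra! hcon
  have hl : ∀ n : ℕ, (0 : ℝ) < (1 / 2) ^ (n * n) := fun n => by positivity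
  have hm : ∀ n : ℕ, (0 : ℝ) < ((1 / 2) ^ (n * n) * 2 ^ n) ^ k := fun n => by positivity
  choose a b ha hb hab using fun n : ℕ =>
    hcon (n / ((1 / 2) ^ (n * n) * 2 ^ n) ^ k) ((1 / 2) ^ (n * n)) (hl n)
  let e : ℕ → E := fun n =>
    (a n / (1 / 2) ^ (n * n)) • u + (b n / (1 / 2) ^ (n * n)) • v
  have he : Bornology.IsVonNBounded ℝ (range e) := by
    let Λ : ℝ × ℝ →L[ℝ] E := (ContinuousLinearMap.fst ℝ ℝ ℝ).smulRight u +
      (ContinuousLinearMap.snd ℝ ℝ ℝ).smulRight v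
    refine ((NormedSpace.isVonNBounded_closedBall ℝ (ℝ × ℝ) 1).image Λ).subset ?_
    rintro _ ⟨n, rfl⟩
    refine ⟨(a n / (1 / 2) ^ (n * n), b n / (1 / 2) ^ (n * n)), ?_, by simp [Λ, e]⟩
    rw [mem_closedBall_zero_iff, Prod.norm_def]
    simp only [Real.norm_eq_abs, abs_div, abs_of_pos (hl n), sup_le_iff]
    exact ⟨(div_le_one (hl n)).2 (ha n), (div_le_one (hl n)).2 (hb n)⟩
  have hw : Bornology.IsVonNBounded ℝ (range fun _ : ℕ => w) :=
    (Bornology.isVonNBounded_singleton w).subset (by simp)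
  obtain ⟨C, hC⟩ := hf.bounded_probe hU hx he hw k
  obtain ⟨n, hn, hnC⟩ := (hC.and (tendsto_natCast_atTop_atTop.eventually_gt_atTop C)).exists
  have h1 : (1 / 2 : ℝ) ^ (n * n) • e n = a n • u + b n • v := by
    simp only [e, smul_add, smul_smul]
    rw [mul_div_cancel₀ _ (hl n).ne', mul_div_cancel₀ _ (hl n).ne']
  rw [h1, abs_mul, abs_of_pos (hm n)] at hn
  have h2 := hab n
  rw [div_lt_iff₀ (hm n)] at h2
  linarith

end SmoothMaps

section Linearity

theorem diagonal_deriv_eq {φ A B B₂ : ℝ → ℝ → ℝ} {C r D : ℝ} (hr : 0 < r)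
    (hA : ∀ a b, |a| ≤ r → |b| ≤ r → HasDerivAt (fun s => φ s b) (A a b) a)
    (hA' : ∀ a b, |a| ≤ r → |b| ≤ r → |A a b| ≤ C)
    (hB : ∀ a b, |a| ≤ r → |b| ≤ r → HasDerivAt (fun s => φ a s) (B a b) b)
    (hB₂ : ∀ a b, |a| ≤ r → |b| ≤ r → HasDerivAt (fun s => B a s) (B₂ a b) b)
    (hB₂' : ∀ a b, |a| ≤ r → |b| ≤ r → |B₂ a b| ≤ C)
    (hD : HasDerivAt (fun s => φ s s) D 0) : D = A 0 0 + B 0 0 := by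
  have hC : 0 ≤ C := (abs_nonneg _).trans (hA' 0 0 (by simpa using hr.le) (by simpa using hr.le))
  have hconv : ∀ q : ℝ, Convex ℝ (Icc (-q) q) := fun q => convex_Icc _ _
  have h1 : ∀ a b, |a| ≤ r → |b| ≤ r → |φ a b - φ 0 b| ≤ C * |a| := by
    intro a b ha hb
    have := (hconv r).norm_image_sub_le_of_norm_hasDerivWithin_le (f := fun s => φ s b)
      (f' := fun s => A s b) (C := C) (x := 0) (y := a)
      (fun s hs => (hA s b (abs_le.2 hs) hb).hasDerivWithinAt)
      (fun s hs => hA' s b (abs_le.2 hs) hb) ⟨by linarith, hr.le⟩ (abs_le.1 ha)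
    simpa using this
  have h2 : ∀ a b, |a| ≤ r → |b| ≤ r → |B a b - B a 0| ≤ C * |b| := by
    intro a b ha hb
    have := (hconv r).norm_image_sub_le_of_norm_hasDerivWithin_le (f := fun s => B a s)
      (f' := fun s => B₂ a s) (C := C) (x := 0) (y := b)
      (fun s hs => (hB₂ a s ha (abs_le.2 hs)).hasDerivWithinAt)
      (fun s hs => hB₂' a s ha (abs_le.2 hs)) ⟨by linarith, hr.le⟩ (abs_le.1 hb)
    simpa using this
  have h3 : ∀ a b, |a| ≤ r → |b| ≤ r → |φ a b - φ a 0 - b * B a 0| ≤ C * b ^ 2 := by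
    intro a b ha hb
    have := (hconv |b|).norm_image_sub_le_of_norm_hasDerivWithin_le
      (f := fun s => φ a s - s * B a 0)
      (f' := fun s => B a s - 1 * B a 0) (C := C * |b|) (x := 0) (y := b)
      (fun s hs => ((hB a s ha ((abs_le.2 hs).trans hb)).sub
        ((hasDerivAt_id s).mul_const _)).hasDerivWithinAt)
      (fun s hs => by
        rw [one_mul]
        refine (h2 a s ha ((abs_le.2 hs).trans hb)).trans ?_
        exact mul_le_mul_of_nonneg_left (abs_le.2 hs) hC)
      ⟨by simp, abs_nonneg b⟩ (abs_le.1 le_rfl)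
    simp only [zero_mul, sub_zero, Real.norm_eq_abs] at this
    rw [mul_assoc, ← sq, sq_abs] at this
    convert this using 2
    ring
  have h0r : |(0 : ℝ)| ≤ r := by simpa using hr.le
  have h4 : ∀ s, 0 < s → s ≤ r → s ^ 2 ≤ r → |B (s ^ 2) 0 - B 0 0| ≤ 4 * C * s := by
    intro s hs hsr hsr2
    have hs' : |s| ≤ r := by rwa [abs_of_pos hs]
    have ht' : |s ^ 2| ≤ r := by rwa [abs_of_nonneg (sq_nonneg s)]
    have e1 := abs_le.1 (h3 (s ^ 2) s ht' hs')
    have e2 := abs_le.1 (h3 0 s h0r hs')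
    have e3 := h1 (s ^ 2) s ht' hs'
    have e4 := h1 (s ^ 2) 0 ht' h0r
    rw [abs_of_nonneg (sq_nonneg s)] at e3 e4
    have e3 := abs_le.1 e3
    have e4 := abs_le.1 e4
    rw [abs_le]
    constructor
    · by_contra hcon
      have : s * (B (s ^ 2) 0 - B 0 0) < s * -(4 * C * s) :=
        mul_lt_mul_of_pos_left (not_le.1 hcon) hs
      nlinarith
    · by_contra hcon
      have : s * (4 * C * s) < s * (B (s ^ 2) 0 - B 0 0) :=
        mul_lt_mul_of_pos_left (not_le.1 hcon) hs
      nlinarith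
  have hsq : Tendsto (fun s : ℝ => s ^ 2) (𝓝[>] 0) (𝓝[≠] 0) := by
    refine tendsto_nhdsWithin_iff.2 ⟨?_, ?_⟩
    · have : Tendsto (fun s : ℝ => s ^ 2) (𝓝 0) (𝓝 (0 ^ 2)) := (continuous_pow 2).tendsto 0
      simpa using this.mono_left nhdsWithin_le_nhds
    · filter_upwards [self_mem_nhdsWithin] with s hs
      exact (pow_pos hs 2).ne'
  have l1 := ((hasDerivAt_iff_tendsto_slope_zero.1 hD).comp hsq)
  have l2 := ((hasDerivAt_iff_tendsto_slope_zero.1 (hA 0 0 h0r h0r)).comp hsq)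
  have l3 := (l1.sub l2).sub_const (B 0 0)
  have l4 : Tendsto (fun s : ℝ => C * s ^ 2 + 4 * C * s) (𝓝[>] 0) (𝓝 0) := by
    have : Tendsto (fun s : ℝ => C * s ^ 2 + 4 * C * s) (𝓝 0) (𝓝 (C * 0 ^ 2 + 4 * C * 0)) :=
      Continuous.tendsto (by fun_prop) 0
    simpa using this.mono_left nhdsWithin_le_nhds
  have l5 := squeeze_zero_norm' (f := fun s : ℝ =>
    (s ^ 2)⁻¹ * (φ (0 + s ^ 2) (0 + s ^ 2) - φ 0 0) -
      (s ^ 2)⁻¹ * (φ (0 + s ^ 2) 0 - φ 0 0) - B 0 0) ?_ l4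
  · have l6 : D - A 0 0 - B 0 0 = 0 := tendsto_nhds_unique l3 l5
    linarith
  · have hm : Set.Ioo (0 : ℝ) (min r (min 1 r)) ∈ 𝓝[>] (0 : ℝ) :=
      Ioo_mem_nhdsGT (by positivity)
    filter_upwards [hm] with s hs
    have hs0 := hs.1
    obtain ⟨hs1, hs2, hs3⟩ : s < r ∧ s < 1 ∧ s < r := by
      have := hs.2; simp only [lt_min_iff] at this; tauto
    have hsr : s ^ 2 ≤ r := by nlinarith
    have hp : 0 < s ^ 2 := pow_pos hs0 2
    have ht' : |s ^ 2| ≤ r := by rwa [abs_of_pos hp]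
    have e1 := h3 (s ^ 2) (s ^ 2) ht' ht'
    have e2 := h4 s hs0 hs1.le hsr
    have key : (s ^ 2)⁻¹ * (φ (0 + s ^ 2) (0 + s ^ 2) - φ 0 0) -
        (s ^ 2)⁻¹ * (φ (0 + s ^ 2) 0 - φ 0 0) - B 0 0 =
        (s ^ 2)⁻¹ * (φ (s ^ 2) (s ^ 2) - φ (s ^ 2) 0 - s ^ 2 * B (s ^ 2) 0) +
          (B (s ^ 2) 0 - B 0 0) := by
      rw [zero_add]
      field_simp
      ring
    rw [Real.norm_eq_abs, key]
    refine (abs_add_le _ _).trans (add_le_add ?_ e2)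
    rw [abs_mul, abs_of_pos (inv_pos.2 hp), inv_mul_le_iff₀ hp]
    linarith

variable {E F : Type*} [AddCommGroup E] [Module ℝ E] [TopologicalSpace E]
  [AddCommGroup F] [Module ℝ F] [TopologicalSpace F]
  [IsTopologicalAddGroup E] [ContinuousSMul ℝ E]

theorem SmoothMapOn.dirDeriv_add_real {f : E → ℝ} {U : Set E} (hf : SmoothMapOn f U)
    (hU : IsOpen U) {x : E} (hx : x ∈ U) (u v : E) :
    dirDeriv f x (u + v) = dirDeriv f x u + dirDeriv f x v := by
  obtain ⟨C₁, r₁, hr₁, h₁⟩ := hf.locally_bounded hU hx u v u 1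
  obtain ⟨C₂, r₂, hr₂, h₂⟩ := hf.locally_bounded hU hx u v v 2
  have hbox : ∃ r₃ : ℝ, 0 < r₃ ∧ ∀ a b : ℝ, |a| ≤ r₃ → |b| ≤ r₃ → x + (a • u + b • v) ∈ U := by
    have hc : Continuous fun z : ℝ × ℝ => x + (z.1 • u + z.2 • v) := by fun_prop
    have := (hU.preimage hc).mem_nhds (x := ((0 : ℝ), (0 : ℝ))) (by simpa using hx)
    obtain ⟨r, hr, hsub⟩ := Metric.nhds_basis_closedBall.mem_iff.1 this
    refine ⟨r, hr, fun a b ha hb => ?_⟩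
    have hab : ((a, b) : ℝ × ℝ) ∈ Metric.closedBall ((0 : ℝ), (0 : ℝ)) r := ?_
    · exact hsub hab
    rw [Metric.mem_closedBall, Prod.dist_eq]
    simp [ha, hb]
  obtain ⟨r₃, hr₃, h₃⟩ := hbox
  let r := min r₁ (min r₂ r₃)
  have hr : 0 < r := by positivity
  have hrr₁ : r ≤ r₁ := min_le_left _ _
  have hrr₂ : r ≤ r₂ := (min_le_right _ _).trans (min_le_left _ _)
  have hrr₃ : r ≤ r₃ := (min_le_right _ _).trans (min_le_right _ _)
  let φ : ℝ → ℝ → ℝ := fun a b => f (x + (a • u + b • v))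
  have hφa : ∀ a b, |a| ≤ r → |b| ≤ r → ContDiffAt ℝ ∞ (fun s => φ s b) a := by
    intro a b ha hb
    have := hf.contDiffAt_line hU (x := x + b • v) u (t := a) (by
      have := h₃ a b (ha.trans hrr₃) (hb.trans hrr₃)
      rwa [add_comm (a • u), ← add_assoc] at this)
    refine this.congr_of_eventuallyEq (Eventually.of_forall fun s => ?_)
    simp only [φ]
    rw [add_comm (s • u), ← add_assoc]
  have hφb : ∀ a b, |a| ≤ r → |b| ≤ r → ContDiffAt ℝ ∞ (fun s => φ a s) b := by
    intro a b ha hb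
    have := hf.contDiffAt_line hU (x := x + a • u) v (t := b) (by
      have := h₃ a b (ha.trans hrr₃) (hb.trans hrr₃)
      rwa [← add_assoc] at this)
    refine this.congr_of_eventuallyEq (Eventually.of_forall fun s => ?_)
    simp only [φ]
    rw [← add_assoc]
  have hd1 : ∀ a b, iteratedDeriv 1 (fun s : ℝ => f (x + (a • u + b • v) + s • u)) 0 =
      deriv (fun s => φ s b) a := by
    intro a b
    have : (fun s : ℝ => f (x + (a • u + b • v) + s • u)) = fun s => φ (a + s) b := by
      ext s
      simp only [φ]
      congr 1
      rw [add_smul]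
      abel
    rw [this, iteratedDeriv_one, deriv_comp_const_add (f := fun s => φ s b), add_zero]
  have hd2 : ∀ a b, iteratedDeriv 2 (fun s : ℝ => f (x + (a • u + b • v) + s • v)) 0 =
      deriv (deriv fun s => φ a s) b := by
    intro a b
    have : (fun s : ℝ => f (x + (a • u + b • v) + s • v)) = fun s => φ a (b + s) := by
      ext s
      simp only [φ]
      congr 1
      rw [add_smul]
      abel
    rw [this, iteratedDeriv_comp_const_add (f := fun s => φ a s)]
    simp [iteratedDeriv_succ]
  have hdir : ∀ w : E, HasDerivAt (fun s : ℝ => f (x + s • w)) (dirDeriv f x w) 0 :=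
    fun w => hasVelocity_real.1 (hf.hasVelocity_line hU hx w)
  have := diagonal_deriv_eq (φ := φ) (A := fun a b => deriv (fun s => φ s b) a)
    (B := fun a b => deriv (fun s => φ a s) b)
    (B₂ := fun a b => deriv (deriv fun s => φ a s) b) (C := max C₁ C₂)
    (D := dirDeriv f x (u + v)) hr
    (fun a b ha hb => ((hφa a b ha hb).differentiableAt (by simp)).hasDerivAt)
    (fun a b ha hb => by
      rw [← hd1]
      exact (h₁ a b (ha.trans hrr₁) (hb.trans hrr₁)).trans (le_max_left _ _))
    (fun a b ha hb => ((hφb a b ha hb).differentiableAt (by simp)).hasDerivAt)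
    (fun a b ha hb => by
      have h : ContDiffAt ℝ 1 (deriv fun s => φ a s) b := ContDiffAt.derivWithin (hφb a b ha hb) (by
        rw [one_add_one_eq_two]; exact WithTop.coe_le_coe.2 (le_top : (2 : ℕ∞) ≤ ⊤))
      exact (ContDiffAt.differentiableAt h (by simp)).hasDerivAt)
    (fun a b ha hb => by
      rw [← hd2]
      exact (h₂ a b (ha.trans hrr₂) (hb.trans hrr₂)).trans (le_max_right _ _))
    (by simpa [φ] using hdir (u + v))
  rw [this]
  have e1 : deriv (fun s => φ s 0) 0 = dirDeriv f x u := by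
    simpa [φ] using (hdir u).deriv
  have e2 : deriv (fun s => φ 0 s) 0 = dirDeriv f x v := by
    simpa [φ] using (hdir v).deriv
  rw [e1, e2]

end Linearity

section VectorValued

variable {E F : Type*} [AddCommGroup E] [Module ℝ E] [TopologicalSpace E]
  [AddCommGroup F] [Module ℝ F] [TopologicalSpace F]
  [IsTopologicalAddGroup E] [ContinuousSMul ℝ E]
  [IsTopologicalAddGroup F] [ContinuousSMul ℝ F] [T2Space F]

theorem SmoothMapOn.dirDeriv_smul {f : E → F} {U : Set E} (hf : SmoothMapOn f U)
    (hU : IsOpen U) {x : E} (hx : x ∈ U) (a : ℝ) (u : E) :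
    dirDeriv f x (a • u) = a • dirDeriv f x u := by
  apply HasVelocity.velocity_eq
  by_cases ha : a = 0
  · subst ha
    simpa using HasVelocity.const (f x) 0
  · have hm : Tendsto (fun h : ℝ => h * a) (𝓝[≠] 0) (𝓝[≠] 0) := by
      refine tendsto_nhdsWithin_iff.2 ⟨?_, ?_⟩
      · have : Tendsto (fun h : ℝ => h * a) (𝓝 0) (𝓝 (0 * a)) :=
          (continuous_id.mul continuous_const).tendsto 0
        simpa using this.mono_left nhdsWithin_le_nhds
      · filter_upwards [self_mem_nhdsWithin] with h hh
        exact mul_ne_zero hh ha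
    have := (Tendsto.comp (hf.hasVelocity_line hU hx u) hm).const_smul a
    refine this.congr fun h => ?_
    simp only [Function.comp_apply, zero_add, zero_smul, add_zero, smul_smul]
    simp only [zero_mul, zero_smul, add_zero]
    congr 1
    rw [mul_inv]
    field_simp

theorem SmoothMapOn.dirDeriv_add [LocallyConvexSpace ℝ F] {f : E → F} {U : Set E}
    (hf : SmoothMapOn f U) (hU : IsOpen U) {x : E} (hx : x ∈ U) (u v : E) :
    dirDeriv f x (u + v) = dirDeriv f x u + dirDeriv f x v := by
  by_contra hne
  obtain ⟨L, hL⟩ := SeparatingDual.exists_separating_of_ne (R := ℝ) hne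
  apply hL
  have hLf : SmoothMapOn (fun y => L (f y)) U := by
    intro c s hs hc hcU
    obtain ⟨d, hd0, hd⟩ := hf c s hs hc hcU
    exact ⟨fun n t => L (d n t), by funext t; simp [hd0], fun n t ht => (hd n t ht).comp_clm L⟩
  have key : ∀ w, dirDeriv (fun y => L (f y)) x w = L (dirDeriv f x w) := fun w =>
    ((hf.hasVelocity_line hU hx w).comp_clm L).velocity_eq
  rw [map_add, ← key, ← key, ← key]
  exact hLf.dirDeriv_add_real hU hx u v

end VectorValued

/-- A locally convex space (Hausdorff, in all uses below) is convenient if every smooth curve in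
it is the derivative of a smooth curve. -/
class ConvenientSpace (E : Type*) [AddCommGroup E] [Module ℝ E] [TopologicalSpace E]
    [IsTopologicalAddGroup E] [ContinuousSMul ℝ E] [LocallyConvexSpace ℝ E] [T2Space E] :
    Prop where
  exists_antiderivative : ∀ c₁ : ℝ → E, SmoothCurveOn c₁ univ →
    ∃ c₂ : ℝ → E, SmoothCurveOn c₂ univ ∧ ∀ t, HasVelocity c₂ (c₁ t) t

section Manifolds

variable (E : Type*) [AddCommGroup E] [Module ℝ E] [TopologicalSpace E]
  {M : Type*} [TopologicalSpace M]

/-- The charts of `M` are smoothly compatible. -/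
class IsConvenientManifold (M : Type*) [TopologicalSpace M] [ChartedSpace E M] : Prop where
  smooth_transition : ∀ φ ∈ atlas E M, ∀ ψ ∈ atlas E M,
    SmoothMapOn (fun y : E => ψ (φ.symm y)) (φ.symm.trans ψ).source

/-- The kinematic tangent space of `M` at `p`. As usual it is identified with the model space
through the preferred chart `chartAt E p`: the class `[γ]` of a curve through `p` corresponds to
`(chartAt E p ∘ γ)' 0`, see `tangentClass`. -/
abbrev TangentAt (_p : M) : Type _ := E

/-- The kinematic cotangent space of `M` at `p`: the bounded linear functionals on the tangent
space, that is, the smooth ones. On a bornological (for instance Fréchet or Banach) model space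
these are the continuous ones. -/
def CotangentAt (p : M) : Submodule ℝ (Module.Dual ℝ (TangentAt E p)) where
  carrier := {ℓ | ∀ B : Set (TangentAt E p), Bornology.IsVonNBounded ℝ B →
    ∃ C : ℝ, ∀ v ∈ B, |ℓ v| ≤ C}
  zero_mem' := fun _ _ => ⟨0, by simp⟩
  add_mem' := by
    intro ℓ ℓ' h h' B hB
    obtain ⟨C, hC⟩ := h B hB
    obtain ⟨C', hC'⟩ := h' B hB
    exact ⟨C + C', fun v hv => (abs_add_le _ _).trans (add_le_add (hC v hv) (hC' v hv))⟩
  smul_mem' := by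
    intro a ℓ h B hB
    obtain ⟨C, hC⟩ := h B hB
    refine ⟨|a| * C, fun v hv => ?_⟩
    rw [LinearMap.smul_apply, smul_eq_mul, abs_mul]
    exact mul_le_mul_of_nonneg_left (hC v hv) (abs_nonneg a)

/-- The tangent vector at `p` represented by a curve `γ` with `γ 0 = p`. -/
noncomputable def tangentClass [ChartedSpace E M] (p : M) (γ : ℝ → M) : TangentAt E p :=
  velocity (fun t => chartAt E p (γ t)) 0

variable {E}

/-- The coordinate expression in the chart `φ` of a family `η` of covectors, as a function of a
point `y` and a vector `w` of the model space: `η` at the point `φ⁻¹ y` is applied to the tangent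
vector `[s ↦ φ⁻¹ (y + s w)]`. -/
noncomputable def localForm [ChartedSpace E M] (η : ∀ p : M, CotangentAt E p)
    (φ : OpenPartialHomeomorph M E) (z : E × E) : ℝ :=
  (η (φ.symm z.1)).1 (tangentClass E (φ.symm z.1) fun s => φ.symm (z.1 + s • z.2))

variable (E M) in
/-- A kinematic 1-form on `M`: a section of the cotangent bundle, all of whose coordinate
expressions `φ.target × E → ℝ` are smooth. -/
structure OneForm [ChartedSpace E M] where
  toFun : ∀ p : M, CotangentAt E p
  smooth : ∀ φ ∈ atlas E M, SmoothMapOn (localForm toFun φ) (φ.target ×ˢ univ)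

namespace OneForm

variable [ChartedSpace E M]

/-- In the chart at `p`, with `α = localForm η`, the derivative at `p` of `y ↦ α (y, v)` in the
direction `u`. -/
noncomputable def coordDeriv (η : OneForm E M) (p : M) (u v : TangentAt E p) : ℝ :=
  dirDeriv (localForm η.toFun (chartAt E p)) (chartAt E p p, v) (u, 0)

variable [IsTopologicalAddGroup E] [ContinuousSMul ℝ E]

theorem hasDerivAt_coordDeriv (η : OneForm E M) (p : M) (u v : TangentAt E p) :
    HasDerivAt (fun s : ℝ => localForm η.toFun (chartAt E p) (chartAt E p p + s • u, v))
      (coordDeriv η p u v) 0 := by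
  have h := (η.smooth _ (chart_mem_atlas E p)).hasVelocity_line
    ((chartAt E p).open_target.prod isOpen_univ) (x := (chartAt E p p, v))
    ⟨mem_chart_target E p, mem_univ _⟩ ((u, 0) : E × E)
  simpa [coordDeriv] using hasVelocity_real.1 h

theorem coordDeriv_add_left (η : OneForm E M) (p : M) (u u' v : TangentAt E p) :
    coordDeriv η p (u + u') v = coordDeriv η p u v + coordDeriv η p u' v := by
  have h := (η.smooth _ (chart_mem_atlas E p)).dirDeriv_add_real
    ((chartAt E p).open_target.prod isOpen_univ) (x := (chartAt E p p, v))
    ⟨mem_chart_target E p, mem_univ _⟩ ((u, 0) : E × E) (u', 0)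
  simpa [coordDeriv] using h

theorem coordDeriv_smul_left (η : OneForm E M) (p : M) (a : ℝ) (u v : TangentAt E p) :
    coordDeriv η p (a • u) v = a * coordDeriv η p u v := by
  have h := (η.smooth _ (chart_mem_atlas E p)).dirDeriv_smul
    ((chartAt E p).open_target.prod isOpen_univ) (x := (chartAt E p p, v))
    ⟨mem_chart_target E p, mem_univ _⟩ a ((u, 0) : E × E)
  simpa [coordDeriv] using h

theorem eventually_mem_target (p : M) (u : TangentAt E p) :
    ∀ᶠ s : ℝ in 𝓝 0, chartAt E p p + s • u ∈ (chartAt E p).target := by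
  have hc : Continuous fun s : ℝ => chartAt E p p + s • u := by fun_prop
  exact ((chartAt E p).open_target.preimage hc).mem_nhds (by simp)

theorem coordDeriv_neg_bounded (η : OneForm E M) (p : M) (u : TangentAt E p)
    {B : Set (TangentAt E p)} (hB : Bornology.IsVonNBounded ℝ B) :
    ∃ C : ℝ, ∀ v ∈ B, |coordDeriv η p v u| ≤ C := by
  by_contra! hcon
  have hm : ∀ n : ℕ, (0 : ℝ) < (1 / 2) ^ (n * n) * 2 ^ n := fun n => by positivity
  choose v hvB hv using fun n : ℕ => hcon (n / ((1 / 2) ^ (n * n) * 2 ^ n))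
  have hb : Bornology.IsVonNBounded ℝ (range fun _ : ℕ => (0 : E × E)) :=
    (Bornology.isVonNBounded_singleton 0).subset (by simp)
  have hw : Bornology.IsVonNBounded ℝ (range fun n : ℕ => ((v n, 0) : E × E)) := by
    refine (hB.image (ContinuousLinearMap.inl ℝ E E)).subset ?_
    rintro _ ⟨n, rfl⟩
    exact ⟨v n, hvB n, rfl⟩
  obtain ⟨C, hC⟩ := (η.smooth _ (chart_mem_atlas E p)).bounded_probe
    ((chartAt E p).open_target.prod isOpen_univ) (x := (chartAt E p p, u))
    ⟨mem_chart_target E p, mem_univ _⟩ hb hw 1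
  obtain ⟨n, hn, hnC⟩ := (hC.and (tendsto_natCast_atTop_atTop.eventually_gt_atTop C)).exists
  have h1 := (hasDerivAt_coordDeriv η p (v n) u).deriv
  have h2 := hv n
  rw [div_lt_iff₀ (hm n)] at h2
  rw [iteratedDeriv_one, pow_one, abs_mul, abs_of_pos (hm n)] at hn
  simp only [smul_zero, add_zero, Prod.smul_mk, Prod.mk_add_mk] at hn
  rw [h1] at hn
  linarith

variable [LocallyConvexSpace ℝ E] [T2Space E] [IsConvenientManifold E M]

theorem localForm_add (η : OneForm E M) {φ : OpenPartialHomeomorph M E} (hφ : φ ∈ atlas E M)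
    {y : E} (hy : y ∈ φ.target) (w w' : E) :
    localForm η.toFun φ (y, w + w') = localForm η.toFun φ (y, w) + localForm η.toFun φ (y, w') := by
  have h := (IsConvenientManifold.smooth_transition φ hφ _
    (chart_mem_atlas E (φ.symm y))).dirDeriv_add
    (OpenPartialHomeomorph.open_source _) (x := y) (by simp [hy]) w w'
  unfold localForm
  rw [← map_add]
  exact congrArg _ h

theorem localForm_smul (η : OneForm E M) {φ : OpenPartialHomeomorph M E} (hφ : φ ∈ atlas E M)
    {y : E} (hy : y ∈ φ.target) (a : ℝ) (w : E) :
    localForm η.toFun φ (y, a • w) = a * localForm η.toFun φ (y, w) := by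
  have h := (IsConvenientManifold.smooth_transition φ hφ _
    (chart_mem_atlas E (φ.symm y))).dirDeriv_smul
    (OpenPartialHomeomorph.open_source _) (x := y) (by simp [hy]) a w
  unfold localForm
  rw [← smul_eq_mul, ← map_smul]
  exact congrArg _ h

theorem coordDeriv_add_right (η : OneForm E M) (p : M) (u v v' : TangentAt E p) :
    coordDeriv η p u (v + v') = coordDeriv η p u v + coordDeriv η p u v' := by
  refine (hasDerivAt_coordDeriv η p u (v + v')).unique
    (((hasDerivAt_coordDeriv η p u v).add (hasDerivAt_coordDeriv η p u v')).congr_of_eventuallyEq ?_)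
  filter_upwards [eventually_mem_target p u] with s hs
  exact localForm_add η (chart_mem_atlas E p) hs v v'

theorem coordDeriv_smul_right (η : OneForm E M) (p : M) (a : ℝ) (u v : TangentAt E p) :
    coordDeriv η p u (a • v) = a * coordDeriv η p u v := by
  refine (hasDerivAt_coordDeriv η p u (a • v)).unique
    (((hasDerivAt_coordDeriv η p u v).const_mul a).congr_of_eventuallyEq ?_)
  filter_upwards [eventually_mem_target p u] with s hs
  exact localForm_smul η (chart_mem_atlas E p) hs a v

theorem coordDeriv_bounded (η : OneForm E M) (p : M) (u : TangentAt E p)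
    {B : Set (TangentAt E p)} (hB : Bornology.IsVonNBounded ℝ B) :
    ∃ C : ℝ, ∀ v ∈ B, |coordDeriv η p u v| ≤ C := by
  by_contra! hcon
  have hl : ∀ n : ℕ, (0 : ℝ) < (1 / 2) ^ (n * n) := fun n => by positivity
  have hm : ∀ n : ℕ, (0 : ℝ) < (1 / 2) ^ (n * n) * 2 ^ n := fun n => by positivity
  choose v hvB hv using fun n : ℕ =>
    hcon (n / (((1 / 2) ^ (n * n) * 2 ^ n) * (1 / 2) ^ (n * n)))
  have hw : Bornology.IsVonNBounded ℝ (range fun _ : ℕ => ((u, 0) : E × E)) :=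
    (Bornology.isVonNBounded_singleton ((u, 0) : E × E)).subset (by simp)
  have hb : Bornology.IsVonNBounded ℝ (range fun n : ℕ => ((0, v n) : E × E)) := by
    refine (hB.image (ContinuousLinearMap.inr ℝ E E)).subset ?_
    rintro _ ⟨n, rfl⟩
    exact ⟨v n, hvB n, rfl⟩
  obtain ⟨C, hC⟩ := (η.smooth _ (chart_mem_atlas E p)).bounded_probe
    ((chartAt E p).open_target.prod isOpen_univ) (x := (chartAt E p p, 0))
    ⟨mem_chart_target E p, mem_univ _⟩ hb hw 1
  obtain ⟨n, hn, hnC⟩ := (hC.and (tendsto_natCast_atTop_atTop.eventually_gt_atTop C)).exists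
  have h1 := (hasDerivAt_coordDeriv η p u ((1 / 2 : ℝ) ^ (n * n) • v n)).deriv
  have h2 := hv n
  rw [div_lt_iff₀ (mul_pos (hm n) (hl n))] at h2
  rw [iteratedDeriv_one, pow_one, abs_mul, abs_of_pos (hm n)] at hn
  simp only [smul_zero, add_zero, zero_add, Prod.smul_mk, Prod.mk_add_mk] at hn
  rw [h1, coordDeriv_smul_right, abs_mul, abs_of_pos (hl n)] at hn
  linarith

/-- The exterior derivative `dη` at `p`, as a bilinear form on the tangent space: with `α` the
coordinate expression of `η` in the chart at `p`,
`dη (u, v) = D_u (α (·, v)) - D_v (α (·, u))`. -/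
noncomputable def extDeriv (η : OneForm E M) (p : M) : LinearMap.BilinForm ℝ (TangentAt E p) :=
  LinearMap.mk₂ ℝ (fun u v => coordDeriv η p u v - coordDeriv η p v u)
    (fun u u' v => by rw [coordDeriv_add_left, coordDeriv_add_right]; ring)
    (fun a u v => by rw [coordDeriv_smul_left, coordDeriv_smul_right, smul_eq_mul]; ring)
    (fun u v v' => by rw [coordDeriv_add_left, coordDeriv_add_right]; ring)
    (fun a u v => by rw [coordDeriv_smul_left, coordDeriv_smul_right, smul_eq_mul]; ring)

theorem extDeriv_mem_cotangentAt (η : OneForm E M) (p : M) (v : TangentAt E p) :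
    extDeriv η p v ∈ CotangentAt E p := by
  intro B hB
  obtain ⟨C, hC⟩ := coordDeriv_bounded η p v hB
  obtain ⟨C', hC'⟩ := coordDeriv_neg_bounded η p v hB
  exact ⟨C + C', fun w hw => (abs_sub _ _).trans (add_le_add (hC w hw) (hC' w hw))⟩

/-- The horizontal distribution `H = ker η`. -/
def horizontal (η : OneForm E M) (p : M) : Submodule ℝ (TangentAt E p) :=
  LinearMap.ker (η.toFun p).1

/-- The vertical distribution `V = ker dη = {v | dη (v, ·) = 0}`. -/
noncomputable def vertical (η : OneForm E M) (p : M) : Submodule ℝ (TangentAt E p) :=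
  LinearMap.ker (extDeriv η p)

/-- `♭` on the fibre over `p`: `v ↦ ι_v dη + η(v) η`. -/
noncomputable def flat (η : OneForm E M) (p : M) : TangentAt E p →ₗ[ℝ] CotangentAt E p :=
  (extDeriv η p).codRestrict (CotangentAt E p) (extDeriv_mem_cotangentAt η p) +
    (η.toFun p).1.smulRight (η.toFun p)

/-- The bundle morphism `♭ : TM → T'M`, as a map of total spaces. It covers the identity of `M`
and is linear on the fibres. -/
noncomputable def flatMap (η : OneForm E M) :
    (Σ p : M, TangentAt E p) → (Σ p : M, CotangentAt E p) :=
  fun v => ⟨v.1, flat η v.1 v.2⟩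

end OneForm

/-- A bilinear form is weakly non-degenerate if `v ↦ Ω (v, ·)` has trivial kernel. -/
def IsWeaklyNondegenerate {V : Type*} [AddCommGroup V] [Module ℝ V]
    (Ω : LinearMap.BilinForm ℝ V) : Prop :=
  LinearMap.ker Ω = ⊥

end Manifolds

end ConvenientGeometry

/-! ### Linear algebra of `η` and `dη` on the tangent spaces. -/

namespace ConvenientGeometry.OneForm

variable {E : Type*} [AddCommGroup E] [Module ℝ E] [TopologicalSpace E]
  {M : Type*} [TopologicalSpace M] [ChartedSpace E M]

/-! All three conditions can be checked one tangent space at a time, and there they are linear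
algebra of a functional `η_p` and an alternating form `dη_p`. The common core is the condition `H_p
∩ V_p = 0`.

The map `♭` has kernel `H_p ∩ V_p` (`flat_eq_zero_iff`): if `♭(v) = 0`, testing on `v` itself gives
`η(v)² = 0`, because `dη(v, v) = 0`; hence `v` lies in `H_p`, and what remains of `♭(v)` is `dη(v,
·) = 0`. So injectivity of `♭` on the fibre means that `H_p` and `V_p` are disjoint.

Disjointness already forces `T_pM = H_p ⊕ V_p` (`isCompl_of_disjoint`). Degeneracy supplies `ξ ≠ 0`
in `V_p`, and disjointness gives `η(ξ) ≠ 0`; as `H_p` is the kernel of a single functional, `ξ`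
spans a complement of it.

If the sum is direct, a vector of `H_p` that is `dη`-orthogonal to `H_p` is orthogonal to `V_p` as
well, hence to everything, so it lies in `H_p ∩ V_p = 0`. Conversely, every vector of `H_p ∩ V_p` is
in the kernel of `dη` restricted to `H_p`. This closes the circle 1 → 2 → 3 → 1.

Degeneracy is what makes 3 → 1 work: if `dη_p` were non-degenerate and `η_p ≠ 0`, then `V_p = 0` and
`♭` would be injective at `p`, but `H_p` alone would not fill `T_pM`. -/

theorem mem_horizontal (η : OneForm E M) {p : M} {v : TangentAt E p} :
    v ∈ η.horizontal p ↔ (η.toFun p).1 v = 0 := Iff.rfl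

variable [IsTopologicalAddGroup E] [ContinuousSMul ℝ E] [LocallyConvexSpace ℝ E] [T2Space E]
  [IsConvenientManifold E M]

theorem extDeriv_apply (η : OneForm E M) (p : M) (u v : TangentAt E p) :
    η.extDeriv p u v = coordDeriv η p u v - coordDeriv η p v u := rfl

/-- `V` is the kernel in the first argument; antisymmetry makes a vertical vector in the second
argument kill the form too. -/
theorem extDeriv_swap (η : OneForm E M) (p : M) (u v : TangentAt E p) :
    η.extDeriv p u v = -η.extDeriv p v u := by
  rw [extDeriv_apply, extDeriv_apply, neg_sub]

/-- This isolates `η(v)²` when `♭(v)` is evaluated at `v`. -/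
theorem extDeriv_self (η : OneForm E M) (p : M) (v : TangentAt E p) :
    η.extDeriv p v v = 0 := by
  rw [extDeriv_apply, sub_self]

theorem mem_vertical (η : OneForm E M) {p : M} {v : TangentAt E p} :
    v ∈ η.vertical p ↔ η.extDeriv p v = 0 := Iff.rfl

theorem coe_flat_apply (η : OneForm E M) (p : M) (v w : TangentAt E p) :
    (η.flat p v).1 w = η.extDeriv p v w + (η.toFun p).1 v * (η.toFun p).1 w := rfl

/-- Since `♭` covers the identity of `M`, vectors with equal images share their base point, so only
vectors of the same fibre have to be compared. -/
theorem flatMap_injective_iff (η : OneForm E M) :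
    Function.Injective η.flatMap ↔ ∀ p : M, Function.Injective (η.flat p) := by
  refine ⟨fun h p v w hvw => ?_, fun h => ?_⟩
  · have hflat : η.flatMap ⟨p, v⟩ = η.flatMap ⟨p, w⟩ :=
      congrArg (fun α => (⟨p, α⟩ : Σ p : M, CotangentAt E p)) hvw
    exact eq_of_heq (Sigma.mk.inj (h hflat)).2
  · rintro ⟨p, v⟩ ⟨q, w⟩ hvw
    -- Identifying the base points first turns the heterogeneous equality of covectors into an
    -- honest one in a single fibre.
    obtain ⟨rfl, hvw⟩ := Sigma.mk.inj hvw
    exact congrArg (Sigma.mk p) (h p (eq_of_heq hvw))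

/-- `♭` vanishes exactly on `H ∩ V`. -/
theorem flat_eq_zero_iff (η : OneForm E M) {p : M} {v : TangentAt E p} :
    η.flat p v = 0 ↔ v ∈ η.horizontal p ∧ v ∈ η.vertical p := by
  rw [mem_horizontal, mem_vertical]
  refine ⟨fun h => ?_, fun ⟨hH, hV⟩ => Subtype.ext (LinearMap.ext fun w => ?_)⟩
  · have hw : ∀ w, η.extDeriv p v w + (η.toFun p).1 v * (η.toFun p).1 w = 0 := fun w => by
      rw [← coe_flat_apply, h]
      rfl
    -- The choice `w = v` removes the `dη` term and leaves `η(v)² = 0`.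
    have hv : (η.toFun p).1 v = 0 := by
      simpa [extDeriv_self] using hw v
    refine ⟨hv, LinearMap.ext fun w => ?_⟩
    -- With `η(v) = 0` the rank-one term disappears for every `w`.
    simpa [hv] using hw w
  · rw [coe_flat_apply, hH, hV]
    simp

/-- A linear map is injective when its kernel is trivial, and the kernel of `♭` is `H ∩ V`. -/
theorem flat_injective_iff_disjoint (η : OneForm E M) (p : M) :
    Function.Injective (η.flat p) ↔ Disjoint (η.horizontal p) (η.vertical p) := by
  rw [injective_iff_map_eq_zero, Submodule.disjoint_def]
  simp only [flat_eq_zero_iff, and_imp]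

/-- Replaces the kernel of a form on the subtype `H_p` by a condition on vectors of `T_pM`, where it
can be compared with `V_p`. -/
theorem isWeaklyNondegenerate_restrict_horizontal_iff (η : OneForm E M) (p : M) :
    IsWeaklyNondegenerate ((η.extDeriv p).restrict (η.horizontal p)) ↔
      ∀ v ∈ η.horizontal p, (∀ w ∈ η.horizontal p, η.extDeriv p v w = 0) → v = 0 := by
  rw [IsWeaklyNondegenerate, LinearMap.ker_eq_bot']
  refine ⟨fun h v hv hvw => ?_, fun h v hv => ?_⟩
  · exact congrArg Subtype.val (h ⟨v, hv⟩ (LinearMap.ext fun w => hvw w.1 w.2))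
  · exact Subtype.ext (h v.1 v.2 fun w hw => LinearMap.congr_fun hv ⟨w, hw⟩)

/-- If `H ∩ V = 0` and `dη` is degenerate, then a vector of `V` spans a complement of `H`. -/
theorem isCompl_of_disjoint (η : OneForm E M) {p : M}
    (hdeg : ¬ IsWeaklyNondegenerate (η.extDeriv p))
    (hdisj : Disjoint (η.horizontal p) (η.vertical p)) :
    IsCompl (η.horizontal p) (η.vertical p) := by
  refine ⟨hdisj, codisjoint_iff.2 (eq_top_iff.2 fun v _ => ?_)⟩
  -- Degeneracy of `dη_p` is by definition the statement `V_p ≠ ⊥`.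
  obtain ⟨ξ, hξV, hξ0⟩ := Submodule.exists_mem_ne_zero_of_ne_bot hdeg
  have hξ : (η.toFun p).1 ξ ≠ 0 := fun h =>
    hξ0 (Submodule.disjoint_def.1 hdisj ξ (η.mem_horizontal.2 h) hξV)
  -- The coefficient is the one for which `η(v - a ξ) = 0`, so that `v - a ξ` is the projection of
  -- `v` to `H_p` along `ξ`.
  set a := (η.toFun p).1 v / (η.toFun p).1 ξ
  refine Submodule.mem_sup.2 ⟨v - a • ξ, ?_, a • ξ, Submodule.smul_mem _ a hξV,
    sub_add_cancel v _⟩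
  rw [mem_horizontal, map_sub, map_smul, smul_eq_mul, div_mul_cancel₀ _ hξ, sub_self]

/-- Orthogonality to `H` extends to orthogonality to `H + V`, which is the whole tangent space, so
the vector is vertical as well as horizontal. -/
theorem isWeaklyNondegenerate_restrict_horizontal_of_isCompl (η : OneForm E M) {p : M}
    (h : IsCompl (η.horizontal p) (η.vertical p)) :
    IsWeaklyNondegenerate ((η.extDeriv p).restrict (η.horizontal p)) := by
  rw [isWeaklyNondegenerate_restrict_horizontal_iff]
  intro v hv hvH
  refine Submodule.disjoint_def.1 h.disjoint v hv
    (η.mem_vertical.2 (LinearMap.ext fun w => ?_))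
  obtain ⟨x, hx, y, hy, rfl⟩ := Submodule.mem_sup.1 (h.sup_eq_top ▸ Submodule.mem_top (x := w))
  -- For `w = x + y`, the term with `x ∈ H` vanishes by assumption; in the other, `y ∈ V` has to be
  -- moved to the first argument.
  rw [map_add, hvH x hx, extDeriv_swap, η.mem_vertical.1 hy]
  simp

/-- A vertical vector annihilates all of `T_pM`, in particular `H_p`; if it is also horizontal, it
lies in the kernel of the restricted form. -/
theorem disjoint_of_isWeaklyNondegenerate_restrict_horizontal (η : OneForm E M) {p : M}
    (h : IsWeaklyNondegenerate ((η.extDeriv p).restrict (η.horizontal p))) :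
    Disjoint (η.horizontal p) (η.vertical p) := by
  rw [isWeaklyNondegenerate_restrict_horizontal_iff] at h
  exact Submodule.disjoint_def.2 fun v hH hV =>
    h v hH fun w _ => LinearMap.congr_fun (η.mem_vertical.1 hV) w

end ConvenientGeometry.OneForm

/-! ### The equivalence of the three conditions. -/

theorem mainTheorem1 {E : Type*} [AddCommGroup E] [Module ℝ E] [TopologicalSpace E]
    [IsTopologicalAddGroup E] [ContinuousSMul ℝ E] [LocallyConvexSpace ℝ E] [T2Space E]
    [ConvenientGeometry.ConvenientSpace E] (hE : ¬ FiniteDimensional ℝ E)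
    {M : Type*} [TopologicalSpace M] [ChartedSpace E M]
    [ConvenientGeometry.IsConvenientManifold E M]
    (η : ConvenientGeometry.OneForm E M)
    (hdeg : ∀ p : M, ¬ ConvenientGeometry.IsWeaklyNondegenerate (η.extDeriv p)) :
    List.TFAE [
      ∀ p : M, IsCompl (η.horizontal p) (η.vertical p),
      ∀ p : M, ConvenientGeometry.IsWeaklyNondegenerate
        ((η.extDeriv p).restrict (η.horizontal p)),
      Function.Injective η.flatMap] := by
  rw [η.flatMap_injective_iff]
  -- From here on condition 3 reads `H_p ∩ V_p = 0` for every `p`.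
  simp only [η.flat_injective_iff_disjoint]
  tfae_have 1 → 2 := fun h p => η.isWeaklyNondegenerate_restrict_horizontal_of_isCompl (h p)
  tfae_have 2 → 3 := fun h p =>
    η.disjoint_of_isWeaklyNondegenerate_restrict_horizontal (h p)
  -- The nonzero vertical vector given by `hdeg p` upgrades disjointness to a direct sum
  -- decomposition.
  tfae_have 3 → 1 := fun h p => η.isCompl_of_disjoint (hdeg p) (h p)
  tfae_finish
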